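/- All graphs are finite and simple. The size of a graph is its number of edges; a graph is isolate-free if it has no isolated vertex; $\rho(G)$ denotes the largest eigenvalue of the adjacency matrix of $G$. A chorded cycle in $G$ is a cycle $C$ of $G$ for which some edge of $G$ joins two vertices of $C$ and is not an edge of $C$. Write $\cup$ for disjoint union, $kH$ for the disjoint union of $k$ copies of $H$, and $G\vee H$ for the join (the disjoint union of $G$ and $H$ together with all edges between them). For $4\le m\le 8$ put $t=\lfloor m/3\rfloor$, let $\theta(m)$ be the largest root of $x^3-x^2+(t-m)x+m-3t=0$, and let $G_m=K_1\vee(tK_2\cup(m-3t)K_1)$ (so $G_6=K_1\vee 2K_2$). Theorem. Let $G$ be an isolate-free graph of size $m\ge 4$. (i) If $m\le 8$ and $\rho(G)\ge\theta(m)$, then $G$ contains a chorded cycle unless $G\cong G_m$. (ii) If $m\ge 9$ and $\rho(G)\ge\sqrt m$, then $G$ contains a chorded cycle unless $m=9$ and $G$ is isomorphic to one of $K_1\vee 3K_2$, $K_1\vee(2K_2\cup 3K_1)$, $K_1\vee(K_2\cup 6K_1)$, $K_{1,9}$, or $m\ge 10$ and $G\cong K_{1,m}$, or $m\ge 10$ is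 even and $G\cong K_{2,m/2}$. Equivalently, if $G$ contains no chorded cycle, then $\rho(G)\le\theta(m)$ when $m\le 8$, with equality if and only if $G\cong G_m$, and $\rho(G)\le\sqrt m$ when $m\ge 9$, with equality if and only if $G$ is one of the exceptional graphs listed in (ii) for that $m$. Moreover, none of these exceptional graphs (neither $G_m$ for $m \le 8$ nor those in (ii)) contains a chorded cycle. -/

import Mathlib

namespace ChordedCycle

/-- `G` contains a chorded cycle: a cycle together with an edge of `G` that joins two of its
vertices and is not an edge of the cycle. -/
def HasChordedCycle {V : Type*} (G : SimpleGraph V) : Prop :=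
  ∃ (v : V) (c : G.Walk v v) (e : Sym2 V), c.IsCycle ∧ c.IsChord e

/-- The largest eigenvalue of the adjacency matrix
(see `isGreatest_rho`: for a nonempty graph it is attained). -/
noncomputable def rho {V : Type*} [Fintype V] [DecidableEq V] (G : SimpleGraph V)
    [DecidableRel G.Adj] : ℝ :=
  sSup {x : ℝ | Module.End.HasEigenvalue (Matrix.toLin' (G.adjMatrix ℝ)) x}

theorem isGreatest_rho {V : Type*} [Fintype V] [DecidableEq V] [Nonempty V] (G : SimpleGraph V)
    [DecidableRel G.Adj] :
    IsGreatest {x : ℝ | Module.End.HasEigenvalue (Matrix.toLin' (G.adjMatrix ℝ)) x} (rho G) := by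
  have hfin : {x : ℝ | Module.End.HasEigenvalue (Matrix.toLin' (G.adjMatrix ℝ)) x}.Finite :=
    Module.End.finite_hasEigenvalue _
  have hne : {x : ℝ | Module.End.HasEigenvalue (Matrix.toLin' (G.adjMatrix ℝ)) x}.Nonempty := by
    have hH : (G.adjMatrix ℝ).IsHermitian := by
      rw [Matrix.IsHermitian, Matrix.conjTranspose_eq_transpose_of_trivial]
      exact G.isSymm_adjMatrix
    refine ⟨hH.eigenvalues (Classical.arbitrary V), ?_⟩
    rw [Set.mem_ofPred_eq, Module.End.hasEigenvalue_iff_mem_spectrum, Matrix.spectrum_toLin']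
    exact hH.eigenvalues_mem_spectrum_real _
  exact ⟨hne.csSup_mem hfin, fun x hx => le_csSup hfin.bddAbove hx⟩

/-- The largest real root of `x³ - x² + (t - m) x + m - 3 t`, where `t = ⌊m / 3⌋`
(see `isGreatest_theta`: it is attained). -/
noncomputable def theta (m : ℕ) : ℝ :=
  sSup {x : ℝ | x ^ 3 - x ^ 2 + (((m / 3 : ℕ) : ℝ) - m) * x + m - 3 * ((m / 3 : ℕ) : ℝ) = 0}

theorem isGreatest_theta (m : ℕ) :
    IsGreatest {x : ℝ | x ^ 3 - x ^ 2 + (((m / 3 : ℕ) : ℝ) - m) * x + m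
      - 3 * ((m / 3 : ℕ) : ℝ) = 0} (theta m) := by
  have ht : (3 : ℝ) * ((m / 3 : ℕ) : ℝ) ≤ m := by exact_mod_cast Nat.mul_div_le m 3
  have ht0 : (0 : ℝ) ≤ ((m / 3 : ℕ) : ℝ) := Nat.cast_nonneg _
  unfold theta
  generalize ((m / 3 : ℕ) : ℝ) = t at *
  generalize (m : ℝ) = a at *
  have hcont : Continuous fun x : ℝ => x ^ 3 - x ^ 2 + (t - a) * x + a - 3 * t := by fun_prop
  have hcl : IsClosed {x : ℝ | x ^ 3 - x ^ 2 + (t - a) * x + a - 3 * t = 0} :=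
    isClosed_eq hcont continuous_const
  have hbdd : BddAbove {x : ℝ | x ^ 3 - x ^ 2 + (t - a) * x + a - 3 * t = 0} := by
    refine ⟨a + 1, fun x hx => ?_⟩
    by_contra! h
    have hx' : x ^ 3 - x ^ 2 + (t - a) * x + a - 3 * t = 0 := hx
    nlinarith [mul_pos (show 0 < x - 1 - a by linarith) (show 0 < x by linarith),
      mul_pos (mul_pos (show 0 < x - 1 - a by linarith) (show 0 < x by linarith))
        (show 0 < x by linarith), mul_nonneg ht0 (show 0 ≤ x by linarith),
      mul_nonneg (show 0 ≤ a by linarith) (sq_nonneg (x - 1))]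
  have hne : {x : ℝ | x ^ 3 - x ^ 2 + (t - a) * x + a - 3 * t = 0}.Nonempty := by
    have h1 : (fun x : ℝ => x ^ 3 - x ^ 2 + (t - a) * x + a - 3 * t) (-(a + 1)) ≤ 0 := by
      have : 0 ≤ a := by linarith
      simp only
      nlinarith [mul_nonneg ht0 this, mul_nonneg this this, mul_nonneg (mul_nonneg this this) this]
    have h2 : 0 ≤ (fun x : ℝ => x ^ 3 - x ^ 2 + (t - a) * x + a - 3 * t) (a + 1) := by
      have : 0 ≤ a := by linarith
      simp only
      nlinarith [mul_nonneg ht0 this, mul_nonneg this this, mul_nonneg (mul_nonneg this this) this]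
    obtain ⟨x, -, hx⟩ := intermediate_value_Icc (show -(a + 1) ≤ a + 1 by linarith)
      hcont.continuousOn ⟨h1, h2⟩
    exact ⟨x, hx⟩
  exact ⟨hcl.csSup_mem hne hbdd, fun x hx => le_csSup hbdd hx⟩

/-- The join `G ∨ H`: the disjoint union of `G` and `H` with all edges between them added. -/
def join {V W : Type*} (G : SimpleGraph V) (H : SimpleGraph W) : SimpleGraph (V ⊕ W) :=
  (G ⊕g H) ⊔ completeBipartiteGraph V W

/-- The disjoint union `k H` of `k` copies of `H`. -/
def copies {W : Type*} (k : ℕ) (H : SimpleGraph W) : SimpleGraph (Fin k × W) where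
  Adj x y := x.1 = y.1 ∧ H.Adj x.2 y.2
  symm := ⟨fun _ _ h => ⟨h.1.symm, h.2.symm⟩⟩
  loopless := ⟨fun _ h => H.loopless.irrefl _ h.2⟩

/-- The complete graph on `n` vertices. -/
abbrev K (n : ℕ) : SimpleGraph (Fin n) := ⊤

/-- The graph `K₁ ∨ (t K₂ ∪ s K₁)`; for `s = 0` this is `K₁ ∨ t K₂`. -/
abbrev triangleStar (t s : ℕ) :
    SimpleGraph (Fin 1 ⊕ ((Fin t × Fin 2) ⊕ (Fin s × Fin 1))) :=
  join (K 1) (copies t (K 2) ⊕g copies s (K 1))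

/-- `G ≅ G_m`, where `G_m = K₁ ∨ (t K₂ ∪ (m - 3t) K₁)` and `t = ⌊m / 3⌋`. -/
def IsExtremalSmall {V : Type*} (m : ℕ) (G : SimpleGraph V) : Prop :=
  Nonempty (G ≃g triangleStar (m / 3) (m - 3 * (m / 3)))

/-- The extremal graphs of size `m ≥ 9`. -/
def IsExtremalLarge {V : Type*} (m : ℕ) (G : SimpleGraph V) : Prop :=
  (m = 9 ∧
    (Nonempty (G ≃g triangleStar 3 0) ∨
      Nonempty (G ≃g triangleStar 2 3) ∨
      Nonempty (G ≃g triangleStar 1 6) ∨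
      Nonempty (G ≃g completeBipartiteGraph (Fin 1) (Fin 9)))) ∨
  (10 ≤ m ∧
    (Nonempty (G ≃g completeBipartiteGraph (Fin 1) (Fin m)) ∨
      (Even m ∧ Nonempty (G ≃g completeBipartiteGraph (Fin 2) (Fin (m / 2))))))

end ChordedCycle

open SimpleGraph

namespace ChordedCycle

/-! ### Short chorded cycles, and the degree condition at a chord -/

section Cycles

variable {V : Type*} {G : SimpleGraph V}

/-! Suppose there is no chorded cycle, and let `r > 2` be an eigenvalue with `m ≤ r ^ 2`. Take
absolute values of an eigenvector and scale the maximum to 1, attained at `u`. Let `N` be the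
neighbourhood of `u`, `T ⊆ N` the vertices on triangles through `u`, `W` the vertices outside `N ∪
{u}`, and `A ⊆ W` those with a neighbour in `T`. Forbidding chorded 4- and 5-cycles makes `G[N]` a
perfect matching on `T` plus isolated vertices, and gives each vertex of `A` exactly one neighbour
in `N`.

Summing the eigenvalue inequality over `N`, `T` and `A`, and counting edges by region, yields `(r -
1) (r ^ 2 - m) ≤ (3 - r) t`, where `2 t = |T|` (`spectral_bound`). A nonempty `A` only makes this
strict (`weight_attached_lt`). In the equality case `A` is empty, `W` is independent, and a vertex
of `W` with one neighbour in `N` is joined to all of `N`. Without isolated vertices this leaves a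
triangle star if `t > 0`, and a complete bipartite graph if `t = 0`; the latter has a side of size
at most 2, since `K_{3,3}` has a chorded 6-cycle (`spectral_dichotomy`).

With `t = ⌊m / 3⌋`, the difference of the two sides is exactly the cubic defining `theta m`. For `m
≤ 8`, `theta m > √m`, so `r ≥ theta m` makes the left side positive and forces `r < 3`; as `3 t ≤
m`, the right side is largest at `t = ⌊m / 3⌋`, so equality holds. For `m ≥ 9` and `r ≥ √m ≥ 3` the
two sides have opposite signs, so both vanish: `r ^ 2 = m`, and `t = 0` or `r = 3`. Conversely,
explicit eigenvectors show that the exceptional graphs reach the bounds. -/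

theorem hasChordedCycle_of_four_cycle {u a b c : V} (hua : G.Adj u a) (hab : G.Adj a b)
    (hbc : G.Adj b c) (hcu : G.Adj c u) (hub : G.Adj u b) (hac : a ≠ c) :
    HasChordedCycle G := by
  refine ⟨u, .cons hua (.cons hab (.cons hbc (.cons hcu .nil))), s(u, b), ?_, ?_⟩
  · have := hua.ne; have := hab.ne; have := hbc.ne; have := hcu.ne; have := hub.ne
    simp [Walk.cons_isCycle_iff]
    grind
  · have := hua.ne; have := hab.ne; have := hbc.ne; have := hcu.ne; have := hub.ne
    simp [Walk.isChord_sym2Mk]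
    grind

theorem hasChordedCycle_of_five_cycle {u b a w c : V} (hub : G.Adj u b) (hba : G.Adj b a)
    (haw : G.Adj a w) (hwc : G.Adj w c) (hcu : G.Adj c u) (hua : G.Adj u a)
    (huw : u ≠ w) (hbw : b ≠ w) (hbc : b ≠ c) (hac : a ≠ c) :
    HasChordedCycle G := by
  refine ⟨u, .cons hub (.cons hba (.cons haw (.cons hwc (.cons hcu .nil)))), s(u, a), ?_, ?_⟩
  · have := hub.ne; have := hba.ne; have := haw.ne; have := hwc.ne; have := hcu.ne
    have := hua.ne
    simp [Walk.cons_isCycle_iff]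
    grind
  · have := hub.ne; have := hba.ne; have := haw.ne; have := hwc.ne; have := hcu.ne
    have := hua.ne
    simp [Walk.isChord_sym2Mk]
    grind

/-- A hexagon alternating between the two triples has its long diagonals as chords. -/
theorem hasChordedCycle_of_three_three {f g : Fin 3 → V} (hf : f.Injective) (hg : g.Injective)
    (h : ∀ i j, G.Adj (f i) (g j)) : HasChordedCycle G := by
  have hfg : ∀ i j, f i ≠ g j := fun i j => (h i j).ne
  have f01 : f 0 ≠ f 1 := hf.ne (by decide)
  have f02 : f 0 ≠ f 2 := hf.ne (by decide)
  have f12 : f 1 ≠ f 2 := hf.ne (by decide)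
  have g01 : g 0 ≠ g 1 := hg.ne (by decide)
  have g02 : g 0 ≠ g 2 := hg.ne (by decide)
  have g12 : g 1 ≠ g 2 := hg.ne (by decide)
  refine ⟨f 0, .cons (h 0 0) (.cons (h 1 0).symm (.cons (h 1 1) (.cons (h 2 1).symm
    (.cons (h 2 2) (.cons (h 0 2).symm .nil))))), s(f 0, g 1), ?_, ?_⟩
  · simp [Walk.cons_isCycle_iff]
    grind
  · simp [Walk.isChord_sym2Mk, h]
    grind

theorem exists_three_adj_of_isChord {v : V} {c : G.Walk v v} (hc : c.IsCycle) {p q : V}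
    (h : c.IsChord s(p, q)) :
    ∃ a b d, G.Adj p a ∧ G.Adj p b ∧ G.Adj p d ∧ a ≠ b ∧ a ≠ d ∧ b ≠ d := by
  obtain ⟨hpq, hne, hp, -⟩ := Walk.isChord_sym2Mk.1 h
  obtain ⟨a, b, hab, hs⟩ := Set.ncard_eq_two.1 (hc.ncard_neighborSet_toSubgraph_eq_two hp)
  have key : ∀ x ∈ c.toSubgraph.neighborSet p, G.Adj p x ∧ x ≠ q := by
    intro x hx
    have hx' : c.toSubgraph.Adj p x := hx
    refine ⟨hx'.adj_sub, ?_⟩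
    rintro rfl
    exact hne (Walk.mem_edges_toSubgraph c |>.1 hx')
  have ha := key a (by simp [hs])
  have hb := key b (by simp [hs])
  exact ⟨a, b, q, ha.1, hb.1, hpq, hab, ha.2, hb.2⟩

/-- Both ends of a chord of a cycle have at least three neighbours. -/
theorem HasChordedCycle.exists_adj (h : HasChordedCycle G) :
    ∃ p q, G.Adj p q ∧
      (∃ a b d, G.Adj p a ∧ G.Adj p b ∧ G.Adj p d ∧ a ≠ b ∧ a ≠ d ∧ b ≠ d) ∧
      (∃ a b d, G.Adj q a ∧ G.Adj q b ∧ G.Adj q d ∧ a ≠ b ∧ a ≠ d ∧ b ≠ d) := by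
  obtain ⟨v, c, e, hc, he⟩ := h
  induction e with | h p q =>
  refine ⟨p, q, (Walk.isChord_sym2Mk.1 he).1, exists_three_adj_of_isChord hc he,
    exists_three_adj_of_isChord (q := p) hc ?_⟩
  rwa [Sym2.eq_swap]

end Cycles

/-! ### The exceptional graphs have no chorded cycle -/

section Extremal

theorem triangleStar_adj_inr {t s : ℕ} (x y : (Fin t × Fin 2) ⊕ (Fin s × Fin 1)) :
    (triangleStar t s).Adj (Sum.inr x) (Sum.inr y) ↔
      ∃ i j k, x = Sum.inl (i, j) ∧ y = Sum.inl (i, k) ∧ j ≠ k := by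
  rcases x with ⟨i, j⟩ | ⟨i, j⟩ <;> rcases y with ⟨i', j'⟩ | ⟨i', j'⟩ <;>
    simp [triangleStar, join, copies]
  · grind
  · intro _
    exact Subsingleton.elim _ _

theorem triangleStar_adj_inl_inr {t s : ℕ} (z : Fin 1)
    (y : (Fin t × Fin 2) ⊕ (Fin s × Fin 1)) :
    (triangleStar t s).Adj (Sum.inl z) (Sum.inr y) := by
  simp [triangleStar, join]

theorem not_triangleStar_adj_inl_inl {t s : ℕ} (z z' : Fin 1) :
    ¬ (triangleStar t s).Adj (Sum.inl z) (Sum.inl z') := by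
  simp [triangleStar, join, Subsingleton.elim z z']

/-- Only the centre can have three neighbours, while a chord needs two distinct such ends. -/
theorem not_hasChordedCycle_of_iso_triangleStar {V : Type*} {G : SimpleGraph V} {t s : ℕ}
    (e : G ≃g triangleStar t s) : ¬ HasChordedCycle G := by
  intro h
  obtain ⟨p, q, hpq, hp, hq⟩ := h.exists_adj
  have key : ∀ p, (∃ a b d, G.Adj p a ∧ G.Adj p b ∧ G.Adj p d ∧ a ≠ b ∧ a ≠ d ∧ b ≠ d) →
      e p = Sum.inl 0 := by
    rintro p ⟨a, b, d, ha, hb, hd, hab, had, hbd⟩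
    rw [← e.map_adj_iff] at ha hb hd
    have hab' := e.injective.ne hab
    have had' := e.injective.ne had
    have hbd' := e.injective.ne hbd
    generalize e p = p' at *
    generalize e a = a' at *
    generalize e b = b' at *
    generalize e d = d' at *
    rcases p' with p' | p'
    · rw [Subsingleton.elim p' 0]
    · exfalso
      have h0 : ∀ x : Fin 1 ⊕ ((Fin t × Fin 2) ⊕ (Fin s × Fin 1)),
          x = Sum.inl 0 ∨ ∃ y, x = Sum.inr y := by
        rintro (x | x)
        · exact Or.inl (by rw [Subsingleton.elim x 0])
        · exact Or.inr ⟨x, rfl⟩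
      rcases h0 a' with rfl | ⟨a', rfl⟩ <;> rcases h0 b' with rfl | ⟨b', rfl⟩ <;>
        rcases h0 d' with rfl | ⟨d', rfl⟩ <;>
        (try simp only [triangleStar_adj_inr] at ha hb hd) <;> grind
  rw [← e.map_adj_iff, key p hp, key q hq] at hpq
  exact hpq.ne rfl

/-- A vertex with three neighbours must lie on the side of size `a ≤ 2`, and two vertices of that
side are never adjacent. -/
theorem not_hasChordedCycle_of_iso_completeBipartiteGraph {V W : Type*} {G : SimpleGraph V}
    {a : ℕ} (ha : a ≤ 2) (e : G ≃g completeBipartiteGraph (Fin a) W) :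
    ¬ HasChordedCycle G := by
  intro h
  obtain ⟨p, q, hpq, hp, hq⟩ := h.exists_adj
  have key : ∀ p, (∃ a b d, G.Adj p a ∧ G.Adj p b ∧ G.Adj p d ∧ a ≠ b ∧ a ≠ d ∧ b ≠ d) →
      (e p).isLeft := by
    rintro p ⟨a, b, d, ha, hb, hd, hab, had, hbd⟩
    rw [← e.map_adj_iff] at ha hb hd
    have hab' := e.injective.ne hab
    have had' := e.injective.ne had
    have hbd' := e.injective.ne hbd
    generalize e p = p' at *
    generalize e a = a' at *
    generalize e b = b' at *
    generalize e d = d' at *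
    rcases p' with p' | p'
    · rfl
    · exfalso
      rcases a' with a' | a' <;> rcases b' with b' | b' <;> rcases d' with d' | d' <;>
        simp at ha hb hd
      have h1 : (a' : ℕ) ≠ b' := fun h => hab' (by rw [Fin.ext h])
      have h2 : (a' : ℕ) ≠ d' := fun h => had' (by rw [Fin.ext h])
      have h3 : (b' : ℕ) ≠ d' := fun h => hbd' (by rw [Fin.ext h])
      omega
  have h1 := key p hp
  have h2 := key q hq
  rw [← e.map_adj_iff] at hpq
  simp [← Sum.not_isLeft, h1, h2] at hpq

end Extremal

/-! ### Local structure around a vertex -/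

section Local

variable {V : Type*} {G : SimpleGraph V}

theorem eq_of_adj_of_adj_neighborSet (hG : ¬ HasChordedCycle G) {u a b c : V} (hua : G.Adj u a)
    (hub : G.Adj u b) (huc : G.Adj u c) (hab : G.Adj a b) (hac : G.Adj a c) : b = c := by
  by_contra hbc
  exact hG (hasChordedCycle_of_four_cycle hub hab.symm hac huc.symm hua hbc)

/-- A second neighbour `c` of `w` gives the 4-cycle `u a w b` with chord `ab` if `c = b`, and
otherwise the 5-cycle `u b a w c` with chord `ua`. -/
theorem eq_of_adj_triangle (hG : ¬ HasChordedCycle G) {u a b w c : V} (hua : G.Adj u a)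
    (hub : G.Adj u b) (hab : G.Adj a b) (huw : ¬ G.Adj u w) (hne : w ≠ u) (hwa : G.Adj w a)
    (huc : G.Adj u c) (hwc : G.Adj w c) : c = a := by
  by_contra hca
  by_cases hcb : c = b
  · subst hcb
    exact hne (eq_of_adj_of_adj_neighborSet hG hab hua.symm hwa.symm huc.symm hwc.symm).symm
  · refine hG (hasChordedCycle_of_five_cycle hub hab.symm hwa.symm hwc huc.symm hua hne.symm ?_
      (Ne.symm hcb) (Ne.symm hca))
    rintro rfl
    exact huw hub

end Local

/-! ### The real inequalities behind the spectral estimate -/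

section Scalars

/-- Attached vertices (`k` of them) contribute fewer units to the eigenvalue sums than their edges
cost. Here `E` is the degree sum inside `W` and `EA` its part over `A`; the 3 in `hm` counts the
edges of one triangle at `u`. -/
theorem weight_attached_lt {r k E EA : ℝ} (hr : 2 < r) (hk : 1 ≤ k) (hE : 0 ≤ E) (hEA : EA ≤ E)
    (h1 : k < 2 → 2 * EA ≤ E) (hm : 3 + k + E / 2 ≤ r ^ 2) :
    k + EA < (r - 1) * (k + E / 2) := by
  rcases lt_or_ge k 2 with hk2 | hk2
  · nlinarith [h1 hk2, mul_pos (sub_pos.2 hr) (show 0 < k + E / 2 by linarith)]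
  -- If it failed, `EA ≤ E` and `k ≥ 2` would give `r n ≤ 3 n - 2` with `n = k + E / 2`. Squaring
  -- against `3 + n ≤ r ^ 2` leaves `(n - 2) ^ 3 + 4 ≤ 0`, impossible for `n ≥ 2`.
  · by_contra! hcon
    set n := k + E / 2 with hn
    have h2 : r * n ≤ 3 * n - 2 := by nlinarith
    have h3 : (r * n) ^ 2 ≤ (3 * n - 2) ^ 2 := pow_le_pow_left₀ (by nlinarith) h2 2
    have h4 : (3 + n) * n ^ 2 ≤ r ^ 2 * n ^ 2 :=
      mul_le_mul_of_nonneg_right (by linarith) (sq_nonneg n)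
    have h5 : 0 ≤ (n - 2) ^ 3 := pow_nonneg (by linarith) 3
    nlinarith

/-- Adding `h1`, `h2`, `h3`, `h4` with multipliers `r (r - 1)`, `r - 1`, `1`, `1` eliminates `P`,
`X` and `Y`. Replacing `d` by means of the edge count leaves the claim plus the term `k + EA - (r -
1) (k + E / 2)`, which is never positive. -/
theorem spectral_scalar_inequality {r m P X Y Z Z' k E EA d t : ℝ} (hr : 2 < r) (hm : m ≤ r ^ 2)
    (h1 : r ≤ P) (h2 : r * P ≤ d + X + Y + Z) (h3 : r * X ≤ t + X + Y) (h4 : r * Y ≤ k + EA)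
    (hZ : Z ≤ Z') (hmm : 2 * m = 2 * d + t + 2 * (k + Z') + E) (hEA : EA ≤ E) (hE : 0 ≤ E)
    (hZ0 : 0 ≤ Z') (hk : k = 0 ∨ 1 ≤ k) (hk1 : k < 2 → 2 * EA ≤ E)
    (hkt : k ≠ 0 → 3 ≤ d + t / 2) :
    (r - 1) * (r ^ 2 - m) ≤ (3 - r) * (t / 2) ∧
      ((r - 1) * (r ^ 2 - m) = (3 - r) * (t / 2) →
        P = r ∧ Z = Z' ∧ k = 0 ∧ E = 0 ∧ r * P = d + X + Y + Z) := by
  have hr1 : 0 < r - 1 := by linarith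
  have hS : k + EA ≤ (r - 1) * (k + E / 2) ∧ (k + EA = (r - 1) * (k + E / 2) → k = 0 ∧ E = 0) := by
    rcases hk with rfl | hk
    · have := hk1 (by norm_num)
      constructor
      · nlinarith
      · intro h
        refine ⟨rfl, ?_⟩
        nlinarith
    · have := weight_attached_lt hr hk hE hEA hk1 (by linarith [hkt (by linarith)])
      exact ⟨this.le, fun h => absurd h this.ne⟩
  have e1 := mul_le_mul_of_nonneg_left h1 (mul_nonneg hr1.le (show 0 ≤ r by linarith))
  have e2 := mul_le_mul_of_nonneg_left h2 hr1.le
  have e3 := mul_le_mul_of_nonneg_left hZ hr1.le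
  have hm' : m = d + t / 2 + (k + Z') + E / 2 := by linarith
  subst hm'
  refine ⟨by nlinarith [hS.1], fun heq => ?_⟩
  -- Equality in the combined inequality makes each inequality used tight.
  have f1 : (r - 1) * r * r = (r - 1) * r * P := by nlinarith [hS.1]
  have f2 : (r - 1) * (r * P) = (r - 1) * (d + X + Y + Z) := by nlinarith [hS.1]
  have f3 : (r - 1) * Z = (r - 1) * Z' := by nlinarith [hS.1]
  have f4 : k + EA = (r - 1) * (k + E / 2) := by nlinarith [hS.1]
  obtain ⟨hk0, hE0⟩ := hS.2 f4
  exact ⟨(mul_left_cancel₀ (mul_pos hr1 (by linarith)).ne' f1).symm,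
    mul_left_cancel₀ hr1.ne' f3, hk0, hE0, mul_left_cancel₀ hr1.ne' f2⟩

end Scalars

/-! ### Double counting with adjacency matrix entries -/

section Counting

open Finset

variable {V : Type*} {G : SimpleGraph V} [DecidableRel G.Adj]

theorem sum_adjMatrix_eq_one {S : Finset V} {v a : V} (ha : a ∈ S) (hva : G.Adj v a)
    (h : ∀ b ∈ S, G.Adj v b → b = a) : ∑ b ∈ S, G.adjMatrix ℝ v b = 1 := by
  rw [Finset.sum_eq_single_of_mem a ha]
  · simp [hva]
  · intro b hb hba
    have : ¬ G.Adj v b := fun hv => hba (h b hb hv)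
    simp [this]

theorem sum_adjMatrix_eq_zero {S : Finset V} {v : V} (h : ∀ b ∈ S, ¬ G.Adj v b) :
    ∑ b ∈ S, G.adjMatrix ℝ v b = 0 :=
  Finset.sum_eq_zero fun b hb => by simp [h b hb]

theorem adjMatrix_nonneg (v w : V) : 0 ≤ G.adjMatrix ℝ v w := by
  rw [adjMatrix_apply]; split_ifs <;> norm_num

theorem adjMatrix_symm (v w : V) : G.adjMatrix ℝ v w = G.adjMatrix ℝ w v := by
  simp [adjMatrix_apply, G.adj_comm]

theorem sum_sum_adjMatrix_mul (S R : Finset V) (x : V → ℝ) :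
    ∑ a ∈ S, ∑ b ∈ R, G.adjMatrix ℝ a b * x b
      = ∑ b ∈ R, (∑ a ∈ S, G.adjMatrix ℝ b a) * x b := by
  rw [Finset.sum_comm]
  refine Finset.sum_congr rfl fun b _ => ?_
  rw [Finset.sum_mul]
  exact Finset.sum_congr rfl fun a _ => by rw [adjMatrix_symm]

theorem sum_sum_adjMatrix_comm (S R : Finset V) :
    ∑ a ∈ S, ∑ b ∈ R, G.adjMatrix ℝ a b = ∑ b ∈ R, ∑ a ∈ S, G.adjMatrix ℝ b a := by
  simpa using sum_sum_adjMatrix_mul (G := G) S R fun _ => 1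

/-- Edges from a single vertex to `W` occur twice among ordered pairs in `W`, once from each end. -/
theorem two_mul_sum_adjMatrix_le [DecidableEq V] {A W : Finset V} (hAW : A ⊆ W) (hA : A.card ≤ 1) :
    2 * ∑ a ∈ A, ∑ w ∈ W, G.adjMatrix ℝ a w ≤ ∑ v ∈ W, ∑ w ∈ W, G.adjMatrix ℝ v w := by
  have h0 : ∑ a ∈ A, ∑ b ∈ A, G.adjMatrix ℝ a b = 0 :=
    Finset.sum_eq_zero fun a ha => Finset.sum_eq_zero fun b hb => by
      simp [Finset.card_le_one.1 hA a ha b hb]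
  have h1 : ∀ v, ∑ w ∈ W \ A, G.adjMatrix ℝ v w + ∑ w ∈ A, G.adjMatrix ℝ v w
      = ∑ w ∈ W, G.adjMatrix ℝ v w := fun v => Finset.sum_sdiff hAW
  have h2 := Finset.sum_sdiff (f := fun v => ∑ w ∈ W, G.adjMatrix ℝ v w) hAW
  have h3 : ∑ v ∈ W \ A, ∑ w ∈ A, G.adjMatrix ℝ v w ≤ ∑ v ∈ W \ A, ∑ w ∈ W, G.adjMatrix ℝ v w :=
    Finset.sum_le_sum fun v _ => Finset.sum_le_sum_of_subset_of_nonneg hAW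
      fun w _ _ => adjMatrix_nonneg v w
  have h4 : ∑ a ∈ A, ∑ w ∈ W, G.adjMatrix ℝ a w = ∑ a ∈ A, ∑ w ∈ W \ A, G.adjMatrix ℝ a w := by
    simp_rw [← h1]
    rw [Finset.sum_add_distrib, h0, add_zero]
  rw [sum_sum_adjMatrix_comm, ← h4] at h3
  linarith

variable {V : Type*} [Fintype V] [DecidableEq V] (G : SimpleGraph V) [DecidableRel G.Adj]

theorem sum_eq_self_add_neighbors_add_rest (u : V) (f : V → ℝ) :
    ∑ v, f v = f u + ∑ v ∈ G.neighborFinset u, f v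
      + ∑ v ∈ (insert u (G.neighborFinset u))ᶜ, f v := by
  rw [← Finset.sum_insert (G.notMem_neighborFinset_self u), Finset.sum_add_sum_compl]

variable {G}

/-- The terms count, each edge twice, the edges at `u`, inside the neighbourhood, between it and the
rest, and inside the rest. -/
theorem two_mul_card_edgeFinset_eq (u : V) :
    2 * (G.edgeFinset.card : ℝ) = 2 * ((G.neighborFinset u).card : ℝ)
      + ∑ a ∈ G.neighborFinset u, ∑ b ∈ G.neighborFinset u, G.adjMatrix ℝ a b
      + 2 * ∑ w ∈ (insert u (G.neighborFinset u))ᶜ, ∑ a ∈ G.neighborFinset u, G.adjMatrix ℝ w a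
      + ∑ w ∈ (insert u (G.neighborFinset u))ᶜ,
          ∑ v ∈ (insert u (G.neighborFinset u))ᶜ, G.adjMatrix ℝ w v := by
  set N := G.neighborFinset u with hN
  set W := (insert u N)ᶜ with hW
  have hdeg : 2 * (G.edgeFinset.card : ℝ) = ∑ v, ∑ w, G.adjMatrix ℝ v w := by
    have := G.sum_degrees_eq_twice_card_edges
    rw [← Nat.cast_two, ← Nat.cast_mul, ← this, Nat.cast_sum]
    refine Finset.sum_congr rfl fun v _ => ?_
    simp [adjMatrix_apply, Finset.sum_boole, ← card_neighborFinset_eq_degree,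
      neighborFinset_eq_filter]
  have split := sum_eq_self_add_neighbors_add_rest G u
  rw [← hN, ← hW] at split
  have hu1 : ∀ a ∈ N, G.adjMatrix ℝ u a = 1 := fun a ha => by
    rw [hN, mem_neighborFinset] at ha; simp [ha]
  have hu2 : ∀ a ∈ W, G.adjMatrix ℝ u a = 0 := fun a ha => by
    simp only [hW, hN, mem_compl, Finset.mem_insert, mem_neighborFinset, not_or] at ha; simp [ha.2]
  have hNs : ∑ a ∈ N, ∑ b, G.adjMatrix ℝ a b = N.card + ∑ a ∈ N, ∑ b ∈ N, G.adjMatrix ℝ a b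
      + ∑ w ∈ W, ∑ a ∈ N, G.adjMatrix ℝ w a := by
    simp_rw [split]
    rw [Finset.sum_add_distrib, Finset.sum_add_distrib, sum_sum_adjMatrix_comm N W,
      Finset.sum_congr rfl fun a ha => (adjMatrix_symm a u).trans (hu1 a ha)]
    simp
  have hWs : ∑ a ∈ W, ∑ b, G.adjMatrix ℝ a b = ∑ a ∈ W, ∑ b ∈ N, G.adjMatrix ℝ a b
      + ∑ w ∈ W, ∑ a ∈ W, G.adjMatrix ℝ w a := by
    simp_rw [split]
    rw [Finset.sum_add_distrib, Finset.sum_add_distrib,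
      Finset.sum_congr rfl fun a ha => (adjMatrix_symm a u).trans (hu2 a ha)]
    simp
  rw [hdeg, split (fun v => ∑ w, G.adjMatrix ℝ v w), hNs, hWs, split (fun w => G.adjMatrix ℝ u w),
    Finset.sum_congr rfl hu1, Finset.sum_congr rfl hu2]
  simp
  ring

end Counting

/-! ### The spectral estimate and its equality case -/

section SpectralBound

open Finset

variable {V : Type*} [Fintype V] {G : SimpleGraph V} [DecidableRel G.Adj]

variable (G) in
/-- The neighbours of `u` that lie on a triangle through `u`. -/
noncomputable def triangleNeighbors (u : V) : Finset V :=
  open Classical in {a ∈ G.neighborFinset u | ∃ b, G.Adj u b ∧ G.Adj a b}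

theorem mem_triangleNeighbors {u a : V} :
    a ∈ triangleNeighbors G u ↔ G.Adj u a ∧ ∃ b, G.Adj u b ∧ G.Adj a b := by
  simp [triangleNeighbors]

theorem sum_neighborFinset_adjMatrix [DecidableEq V] (hG : ¬ HasChordedCycle G) {u b : V} (hub : G.Adj u b) :
    ∑ a ∈ G.neighborFinset u, G.adjMatrix ℝ b a = if b ∈ triangleNeighbors G u then 1 else 0 := by
  split_ifs with hb
  · obtain ⟨-, c, huc, hbc⟩ := mem_triangleNeighbors.1 hb
    exact sum_adjMatrix_eq_one ((G.mem_neighborFinset u c).2 huc) hbc fun a ha hba =>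
      eq_of_adj_of_adj_neighborSet hG hub ((G.mem_neighborFinset u a).1 ha) huc hba hbc
  · exact sum_adjMatrix_eq_zero fun a ha hba =>
      hb (mem_triangleNeighbors.2 ⟨hub, a, (G.mem_neighborFinset u a).1 ha, hba⟩)

theorem sum_triangleNeighbors_adjMatrix [DecidableEq V] (hG : ¬ HasChordedCycle G) {u b : V} (hub : G.Adj u b) :
    ∑ a ∈ triangleNeighbors G u, G.adjMatrix ℝ b a
      = if b ∈ triangleNeighbors G u then 1 else 0 := by
  split_ifs with hb
  · obtain ⟨-, c, huc, hbc⟩ := mem_triangleNeighbors.1 hb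
    exact sum_adjMatrix_eq_one (mem_triangleNeighbors.2 ⟨huc, b, hub, hbc.symm⟩) hbc fun a ha hba =>
      eq_of_adj_of_adj_neighborSet hG hub (mem_triangleNeighbors.1 ha).1 huc hba hbc
  · exact sum_adjMatrix_eq_zero fun a ha hba =>
      hb (mem_triangleNeighbors.2 ⟨hub, a, (mem_triangleNeighbors.1 ha).1, hba⟩)

theorem sum_adjMatrix_attached (hG : ¬ HasChordedCycle G) {u w a : V}
    (hw : ¬ G.Adj u w) (hwu : w ≠ u) (ha : a ∈ triangleNeighbors G u) (hwa : G.Adj w a) :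
    ∑ b ∈ G.neighborFinset u, G.adjMatrix ℝ w b = 1 ∧
      ∑ b ∈ triangleNeighbors G u, G.adjMatrix ℝ w b = 1 := by
  obtain ⟨hua, b, hub, hab⟩ := mem_triangleNeighbors.1 ha
  exact ⟨sum_adjMatrix_eq_one ((G.mem_neighborFinset u a).2 hua) hwa fun c hc hwc =>
      eq_of_adj_triangle hG hua hub hab hw hwu hwa ((G.mem_neighborFinset u c).1 hc) hwc,
    sum_adjMatrix_eq_one ha hwa fun c hc hwc =>
      eq_of_adj_triangle hG hua hub hab hw hwu hwa (mem_triangleNeighbors.1 hc).1 hwc⟩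

/-- The main spectral estimate: `x` is a nonnegative vector with maximum `1` at `u`, on which
the adjacency matrix acts at least as multiplication by `r`. -/
theorem spectral_bound [DecidableEq V] (hG : ¬ HasChordedCycle G) {x : V → ℝ} {u : V} {r : ℝ}
    (hx0 : ∀ v, 0 ≤ x v) (hx1 : ∀ v, x v ≤ 1) (hxu : x u = 1)
    (hsub : ∀ v, r * x v ≤ ∑ w, G.adjMatrix ℝ v w * x w)
    (hr : 2 < r) (hm : (G.edgeFinset.card : ℝ) ≤ r ^ 2) :
    (r - 1) * (r ^ 2 - G.edgeFinset.card) ≤ (3 - r) * ((triangleNeighbors G u).card / 2 : ℝ) ∧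
    ((r - 1) * (r ^ 2 - G.edgeFinset.card) = (3 - r) * ((triangleNeighbors G u).card / 2 : ℝ) →
      ∀ w, w ≠ u → ¬ G.Adj u w →
        (∀ a ∈ triangleNeighbors G u, ¬ G.Adj w a) ∧
        (∀ v, v ≠ u → ¬ G.Adj u v → ¬ G.Adj w v) ∧
        ((∃ a, G.Adj w a ∧ G.Adj u a) → ∀ a, G.Adj u a → G.Adj w a)) := by
  classical
  set N := G.neighborFinset u with hN
  set W := (insert u N)ᶜ with hW
  set T := triangleNeighbors G u with hT
  set A := {w ∈ W | ∃ a ∈ T, G.Adj w a} with hA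
  set M := G.adjMatrix ℝ with hM
  have memN : ∀ a, a ∈ N ↔ G.Adj u a := fun a => by rw [hN, mem_neighborFinset]
  have memW : ∀ w, w ∈ W ↔ w ≠ u ∧ ¬ G.Adj u w := fun w => by
    rw [hW, mem_compl, Finset.mem_insert, memN, not_or]
  have hTN : T ⊆ N := Finset.filter_subset _ _
  have hAW : A ⊆ W := Finset.filter_subset _ _
  have split := sum_eq_self_add_neighbors_add_rest G u
  rw [← hN, ← hW] at split
  have hM0 : ∀ v w, 0 ≤ M v w := adjMatrix_nonneg
  have hMu : ∀ a ∈ N, M a u = 1 := fun a ha => by simp [hM, ((memN a).1 ha).symm]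
  have hMW : ∀ w ∈ W, M w u = 0 := fun w hw => by
    have := ((memW w).1 hw).2
    rw [G.adj_comm] at this
    simp [hM, this]
  have hMuu : M u u = 0 := by simp [hM]
  have dNN : ∀ b ∈ N, ∑ a ∈ N, M b a = if b ∈ T then 1 else 0 := fun b hb =>
    sum_neighborFinset_adjMatrix hG ((memN b).1 hb)
  have dTN : ∀ b ∈ N, ∑ a ∈ T, M b a = if b ∈ T then 1 else 0 := fun b hb =>
    sum_triangleNeighbors_adjMatrix hG ((memN b).1 hb)
  have dA : ∀ w ∈ A, ∑ a ∈ N, M w a = 1 ∧ ∑ a ∈ T, M w a = 1 := fun w hw => by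
    obtain ⟨hwW, a, ha, hwa⟩ := Finset.mem_filter.1 hw
    exact sum_adjMatrix_attached hG ((memW w).1 hwW).2 ((memW w).1 hwW).1 ha hwa
  have dTW : ∀ w ∈ W, ∑ a ∈ T, M w a = if w ∈ A then 1 else 0 := fun w hw => by
    split_ifs with h
    · exact (dA w h).2
    · exact sum_adjMatrix_eq_zero fun a ha hwa => h (Finset.mem_filter.2 ⟨hw, a, ha, hwa⟩)
  have hsN : ∀ a ∈ N, r * x a ≤ 1 + ∑ b ∈ N, M a b * x b + ∑ w ∈ W, M a w * x w := fun a ha => by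
    have := hsub a
    rwa [split, hMu a ha, hxu, one_mul] at this
  have hsW : ∀ w ∈ W, r * x w ≤ ∑ b ∈ N, M w b * x b + ∑ v ∈ W, M w v * x v := fun w hw => by
    have := hsub w
    rwa [split, hMW w hw, zero_mul, zero_add] at this
  have sumT : ∀ f : V → ℝ, ∑ b ∈ N, (if b ∈ T then 1 else 0) * f b = ∑ b ∈ T, f b := fun f => by
    simp [ite_mul, Finset.sum_ite_mem, Finset.inter_eq_right.2 hTN]
  have sumA : ∀ f : V → ℝ, ∑ b ∈ W, (if b ∈ A then 1 else 0) * f b = ∑ b ∈ A, f b := fun f => by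
    simp [ite_mul, Finset.sum_ite_mem, Finset.inter_eq_right.2 hAW]
  have h1 : r ≤ ∑ a ∈ N, x a := by
    have := hsub u
    rw [split, hMuu, hxu, zero_mul, zero_add, mul_one] at this
    refine this.trans (le_of_eq ?_)
    rw [Finset.sum_eq_zero (s := W), add_zero]
    · exact Finset.sum_congr rfl fun a ha => by rw [hM, adjMatrix_symm, ← hM, hMu a ha, one_mul]
    · exact fun w hw => by rw [hM, adjMatrix_symm, ← hM, hMW w hw, zero_mul]
  have swap : ∀ S R : Finset V, ∑ a ∈ S, ∑ b ∈ R, M a b * x b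
      = ∑ b ∈ R, (∑ a ∈ S, M b a) * x b := fun S R => sum_sum_adjMatrix_mul S R x
  have sNN : ∑ b ∈ N, (∑ a ∈ N, M b a) * x b = ∑ b ∈ T, x b := by
    rw [← sumT]; exact Finset.sum_congr rfl fun b hb => by rw [dNN b hb]
  have sTN : ∑ b ∈ N, (∑ a ∈ T, M b a) * x b = ∑ b ∈ T, x b := by
    rw [← sumT]; exact Finset.sum_congr rfl fun b hb => by rw [dTN b hb]
  have sTW : ∑ b ∈ W, (∑ a ∈ T, M b a) * x b = ∑ b ∈ A, x b := by
    rw [← sumA]; exact Finset.sum_congr rfl fun b hb => by rw [dTW b hb]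
  have sNA : ∑ w ∈ A, (∑ a ∈ N, M w a) * x w = ∑ w ∈ A, x w :=
    Finset.sum_congr rfl fun w hw => by rw [(dA w hw).1, one_mul]
  -- Exchanging the sums weights each `x b` by its number of neighbours in `N`: one on `T` and on
  -- `A`, none on `N \ T`.
  have h2e : ∑ a ∈ N, (1 + ∑ b ∈ N, M a b * x b + ∑ w ∈ W, M a w * x w)
      = N.card + ∑ b ∈ T, x b + ∑ w ∈ A, x w + ∑ w ∈ W \ A, (∑ a ∈ N, M w a) * x w := by
    rw [Finset.sum_add_distrib, Finset.sum_add_distrib, swap, swap, sNN,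
      ← Finset.sum_sdiff hAW, sNA]
    simp
    ring
  have h2 : r * ∑ a ∈ N, x a ≤ N.card + ∑ b ∈ T, x b + ∑ w ∈ A, x w
      + ∑ w ∈ W \ A, (∑ a ∈ N, M w a) * x w := by
    rw [← h2e, Finset.mul_sum]
    exact Finset.sum_le_sum hsN
  have h3 : r * ∑ a ∈ T, x a ≤ T.card + ∑ b ∈ T, x b + ∑ w ∈ A, x w := by
    rw [Finset.mul_sum]
    refine (Finset.sum_le_sum fun a ha => hsN a (hTN ha)).trans (le_of_eq ?_)
    rw [Finset.sum_add_distrib, Finset.sum_add_distrib, swap, swap, sTN, sTW]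
    simp
  have h4 : r * ∑ w ∈ A, x w ≤ A.card + ∑ w ∈ A, ∑ v ∈ W, M w v := by
    rw [Finset.mul_sum, Finset.cast_card, ← Finset.sum_add_distrib]
    refine Finset.sum_le_sum fun w hw => (hsW w (hAW hw)).trans (add_le_add ?_ ?_)
    · rw [← (dA w hw).1]
      exact Finset.sum_le_sum fun b _ => mul_le_of_le_one_right (hM0 w b) (hx1 b)
    · exact Finset.sum_le_sum fun b _ => mul_le_of_le_one_right (hM0 w b) (hx1 b)
  have hD0 : ∀ w, 0 ≤ ∑ a ∈ N, M w a := fun w => Finset.sum_nonneg fun a _ => hM0 w a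
  have hZt : ∀ w ∈ W \ A, (∑ a ∈ N, M w a) * x w ≤ ∑ a ∈ N, M w a := fun w _ =>
    mul_le_of_le_one_right (hD0 w) (hx1 w)
  have hcount := two_mul_card_edgeFinset_eq (G := G) u
  rw [← hN, ← hW, ← hM, Finset.sum_congr rfl dNN, ← Finset.sum_sdiff hAW (f := fun w =>
    ∑ a ∈ N, M w a), Finset.sum_congr (rfl : A = A) fun w hw => (dA w hw).1] at hcount
  have hTc : ∑ b ∈ N, (if b ∈ T then (1 : ℝ) else 0) = T.card := by
    simpa using sumT fun _ => 1
  rw [hTc] at hcount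
  have hE0 : ∀ w, 0 ≤ ∑ v ∈ W, M w v := fun w => Finset.sum_nonneg fun a _ => hM0 w a
  have key := spectral_scalar_inequality (m := G.edgeFinset.card) (k := A.card)
    (E := ∑ w ∈ W, ∑ v ∈ W, M w v) (EA := ∑ w ∈ A, ∑ v ∈ W, M w v) hr hm h1 h2 h3 h4
    (Finset.sum_le_sum hZt) (by rw [hcount]; simp; ring)
    (Finset.sum_le_sum_of_subset_of_nonneg hAW fun w _ _ => hE0 w)
    (Finset.sum_nonneg fun w _ => hE0 w) (Finset.sum_nonneg fun w _ => hD0 w)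
    (by
      rcases Nat.eq_zero_or_pos A.card with h | h
      · left; simp [h]
      · right; exact_mod_cast h)
    (fun h => two_mul_sum_adjMatrix_le hAW (by
      have : A.card < 2 := by exact_mod_cast h
      omega))
    (fun h => by
      have hAne : A.Nonempty := Finset.card_ne_zero.1 (by exact_mod_cast h)
      obtain ⟨w, hw⟩ := hAne
      obtain ⟨-, a, ha, -⟩ := Finset.mem_filter.1 hw
      obtain ⟨hua, b, hub, hab⟩ := mem_triangleNeighbors.1 ha
      have hb : b ∈ T := mem_triangleNeighbors.2 ⟨hub, a, hua, hab.symm⟩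
      have h2T : 2 ≤ T.card := Finset.one_lt_card.2 ⟨a, ha, b, hb, hab.ne⟩
      have h2N : (2 : ℝ) ≤ N.card := by exact_mod_cast h2T.trans (Finset.card_le_card hTN)
      have : (2 : ℝ) ≤ T.card := by exact_mod_cast h2T
      linarith)
  refine ⟨key.1, fun heq w hwu hw => ?_⟩
  obtain ⟨hP, hZ, hk, hE, hrP⟩ := key.2 heq
  have hAe : A = ∅ := Finset.card_eq_zero.1 (by exact_mod_cast hk)
  have hwW : w ∈ W := (memW w).2 ⟨hwu, hw⟩
  refine ⟨fun a ha hwa => ?_, fun v hvu hv hwv => ?_, ?_⟩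
  · have : w ∈ A := Finset.mem_filter.2 ⟨hwW, a, ha, hwa⟩
    rw [hAe] at this
    exact absurd this (Finset.notMem_empty w)
  · have e1 := (Finset.sum_eq_zero_iff_of_nonneg fun w _ => hE0 w).1 hE w hwW
    have e2 := (Finset.sum_eq_zero_iff_of_nonneg fun v _ => hM0 w v).1 e1 v ((memW v).2 ⟨hvu, hv⟩)
    simp [hM, hwv] at e2
  · rintro ⟨a₀, hwa₀, hua₀⟩ a hua
    by_contra hwa
    have hEw : ∀ v ∈ W, M w v = 0 := (Finset.sum_eq_zero_iff_of_nonneg fun v _ => hM0 w v).1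
      ((Finset.sum_eq_zero_iff_of_nonneg fun w _ => hE0 w).1 hE w hwW)
    have hwWA : w ∈ W \ A := by rw [hAe, sdiff_empty]; exact hwW
    have hzw := (Finset.sum_eq_sum_iff_of_le hZt).1 hZ w hwWA
    have hDpos : 0 < ∑ a ∈ N, M w a := by
      refine lt_of_lt_of_le ?_ (Finset.single_le_sum (fun a _ => hM0 w a) ((memN a₀).2 hua₀))
      simp [hM, hwa₀]
    -- Tightness of `Z ≤ Z'` forces the maximal entry at every vertex outside `A` that has a
    -- neighbour in `N`.
    have hxw : x w = 1 := mul_left_cancel₀ hDpos.ne' (hzw.trans (mul_one _).symm)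
    -- Tightness of the sum over `N` makes every summand tight, so `r * x a` is at least the
    -- contribution 1 of `u`.
    have hxa : 0 < x a := by
      rw [← h2e, Finset.mul_sum] at hrP
      have := (Finset.sum_eq_sum_iff_of_le hsN).1 hrP a ((memN a).2 hua)
      have n1 : 0 ≤ ∑ b ∈ N, M a b * x b := Finset.sum_nonneg fun b _ => mul_nonneg (hM0 a b) (hx0 b)
      have n2 : 0 ≤ ∑ b ∈ W, M a b * x b := Finset.sum_nonneg fun b _ => mul_nonneg (hM0 a b) (hx0 b)
      by_contra! hcon
      have : x a = 0 := le_antisymm hcon (hx0 a)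
      nlinarith
    -- Now `r = r * x w` is at most the sum of `x` over the neighbours of `w` in `N`, while the sum
    -- over all of `N` is also `r`; omitting the positive entry `x a` is impossible.
    have h5 := hsW w hwW
    rw [hxw, mul_one, Finset.sum_eq_zero (s := W) fun v hv => by rw [hEw v hv, zero_mul],
      add_zero, ← hP] at h5
    refine absurd h5 (not_le.2 (Finset.sum_lt_sum (fun b _ => ?_) ⟨a, (memN a).2 hua, ?_⟩))
    · refine mul_le_of_le_one_left (hx0 b) ?_
      rw [hM, adjMatrix_apply]; split_ifs <;> norm_num
    · simpa [hM, hwa] using hxa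

end SpectralBound

/-! ### Subeigenvectors and lower bounds for the spectral radius -/

section Eigenvectors

variable {V : Type*} [Fintype V] [DecidableEq V] {G : SimpleGraph V} [DecidableRel G.Adj]

/-- Absolute values turn the eigenvalue equation into an inequality by the triangle inequality, so
no Perron vector is needed. -/
theorem exists_normalized_subeigenvector {r : ℝ} (hr : 0 ≤ r)
    (h : Module.End.HasEigenvalue (Matrix.toLin' (G.adjMatrix ℝ)) r) :
    ∃ (x : V → ℝ) (u : V), (∀ v, 0 ≤ x v) ∧ (∀ v, x v ≤ 1) ∧ x u = 1 ∧
      ∀ v, r * x v ≤ ∑ w, G.adjMatrix ℝ v w * x w := by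
  obtain ⟨y, hy⟩ := h.exists_hasEigenvector
  obtain ⟨v₀, hv₀⟩ := Function.ne_iff.1 hy.2
  have : Nonempty V := ⟨v₀⟩
  obtain ⟨u, hu⟩ := Finite.exists_max fun v => |y v|
  have hu0 : 0 < |y u| := (abs_pos.2 hv₀).trans_le (hu v₀)
  refine ⟨fun v => |y v| / |y u|, u, fun v => by positivity,
    fun v => (div_le_one hu0).2 (hu v), div_self hu0.ne', fun v => ?_⟩
  have hv : ∑ w, G.adjMatrix ℝ v w * y w = r * y v := by
    have := congrFun hy.apply_eq_smul v
    simpa [Matrix.toLin'_apply, Matrix.mulVec, dotProduct] using this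
  have : r * |y v| ≤ ∑ w, G.adjMatrix ℝ v w * |y w| := by
    calc r * |y v| = |∑ w, G.adjMatrix ℝ v w * y w| := by rw [hv, abs_mul, abs_of_nonneg hr]
      _ ≤ ∑ w, |G.adjMatrix ℝ v w * y w| := Finset.abs_sum_le_sum_abs _ _
      _ = _ := Finset.sum_congr rfl fun w _ => by rw [abs_mul, abs_of_nonneg (adjMatrix_nonneg v w)]
  simp_rw [← mul_div_assoc, ← Finset.sum_div]
  exact div_le_div_of_nonneg_right this hu0.le

open Classical in
theorem le_rho_of_iso {W : Type*} [Fintype W] {H : SimpleGraph W} (e : G ≃g H) {r : ℝ}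
    {z : W → ℝ} (hz : z ≠ 0) (h : ∀ v, ∑ w, (if H.Adj v w then z w else 0) = r * z v) :
    r ≤ rho G := by
  obtain ⟨w₀, hw₀⟩ := Function.ne_iff.1 hz
  have : Nonempty V := ⟨e.symm w₀⟩
  refine (isGreatest_rho G).2 ?_
  refine Module.End.hasEigenvalue_of_hasEigenvector (x := z ∘ e)
    (Module.End.hasEigenvector_iff.2 ⟨Module.End.mem_eigenspace_iff.2 ?_, ?_⟩)
  · ext v
    rw [Matrix.toLin'_apply, Matrix.mulVec, dotProduct, Pi.smul_apply, smul_eq_mul,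
      Function.comp_apply, ← h (e v), ← e.toEquiv.sum_comp]
    refine Finset.sum_congr rfl fun w _ => ?_
    simp only [adjMatrix_apply, ite_mul, one_mul, zero_mul, Function.comp_apply]
    exact if_congr e.map_adj_iff.symm rfl rfl
  · exact fun h0 => hw₀ (by simpa using congrFun h0 (e.symm w₀))

theorem le_rho_of_iso_triangleStar {t s : ℕ} (e : G ≃g triangleStar t s) {r : ℝ} (hr : 1 < r)
    (h : r ^ 2 * (r - 1) = 2 * t * r + s * (r - 1)) : r ≤ rho G := by
  classical
  -- Centre, triangle vertices and pendant vertices get `r (r - 1)`, `r` and `r - 1`; the equation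
  -- at the centre is then the hypothesis `h`.
  refine le_rho_of_iso e (z := Sum.elim (fun _ => r * (r - 1))
    (Sum.elim (fun _ => r) (fun _ => r - 1))) ?_ ?_
  · intro h0
    have := congrFun h0 (Sum.inl 0)
    simp only [Sum.elim_inl, Pi.zero_apply, mul_eq_zero] at this
    rcases this with h | h <;> linarith
  · rintro (x | ⟨i, j⟩ | x)
    · rw [Subsingleton.elim x 0]
      simp [Fintype.sum_sum_type, triangleStar_adj_inl_inr, not_triangleStar_adj_inl_inl]
      linarith
    · have hl : ∀ x : Fin t × Fin 2, (triangleStar t s).Adj (Sum.inr (Sum.inl (i, j)))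
          (Sum.inr (Sum.inl x)) ↔ x = (i, j + 1) := by
        rintro ⟨i', j'⟩
        simp only [triangleStar_adj_inr]
        fin_cases j <;> fin_cases j' <;> simp
      have hr : ∀ x : Fin s × Fin 1, ¬ (triangleStar t s).Adj (Sum.inr (Sum.inl (i, j)))
          (Sum.inr (Sum.inr x)) := by
        simp [triangleStar_adj_inr]
      simp only [Fintype.sum_sum_type, hl, hr, Sum.elim_inl, Sum.elim_inr,
        (triangleStar_adj_inl_inr _ _).symm]
      simp
      ring
    · simp [Fintype.sum_sum_type, (triangleStar_adj_inl_inr _ _).symm, triangleStar_adj_inr]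

theorem sqrt_le_rho_of_iso_completeBipartiteGraph {a b : ℕ} (ha : 0 < a) (hb : 0 < b)
    (e : G ≃g completeBipartiteGraph (Fin a) (Fin b)) : √((a * b : ℕ) : ℝ) ≤ rho G := by
  classical
  have hs : √((a * b : ℕ) : ℝ) * √((a * b : ℕ) : ℝ) = a * b := by
    rw [Real.mul_self_sqrt (by positivity)]; push_cast; ring
  refine le_rho_of_iso e (z := Sum.elim (fun _ => √((a * b : ℕ) : ℝ)) (fun _ => (a : ℝ))) ?_ ?_
  · intro h0
    have := congrFun h0 (Sum.inr ⟨0, hb⟩)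
    simp at this
    omega
  · rintro (x | x)
    · simp [Fintype.sum_sum_type] at hs ⊢
      linarith
    · simp [Fintype.sum_sum_type]
      ring

end Eigenvectors

/-! ### Recognising complete bipartite graphs -/

section Bipartite

theorem card_edgeFinset_of_iso_completeBipartiteGraph {V : Type*} {G : SimpleGraph V}
    [Fintype G.edgeSet] {a b : ℕ} (e : G ≃g completeBipartiteGraph (Fin a) (Fin b)) :
    G.edgeFinset.card = a * b := by
  classical
  have := encard_edgeSet_completeBipartiteGraph (W₁ := Fin a) (W₂ := Fin b)
  rw [e.card_edgeFinset_eq, ← ENat.natCast_inj, ← Set.encard_coe_eq_coe_finsetCard, coe_edgeFinset, this]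
  simp

variable {V : Type*} {G : SimpleGraph V}

theorem nonempty_iso_completeBipartiteGraph [Fintype V] [DecidableEq V] {S : Finset V}
    (h : ∀ v w, G.Adj v w ↔ (v ∈ S ↔ w ∉ S)) :
    Nonempty (G ≃g completeBipartiteGraph (Fin S.card) (Fin Sᶜ.card)) := by
  let e₁ : {v // v ∈ S} ≃ Fin S.card := S.equivFin
  let e₂ : {v // ¬ v ∈ S} ≃ Fin Sᶜ.card := Fintype.equivFinOfCardEq (by
    rw [Fintype.card_subtype, Finset.compl_eq_univ_sdiff]; congr 1; ext; simp)
  let e := (Equiv.sumCongr e₁ e₂).symm.trans (Equiv.sumCompl (fun v => v ∈ S))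
  refine ⟨RelIso.symm ⟨e, ?_⟩⟩
  have hl : ∀ x, e (Sum.inl x) ∈ S := fun x => by simp [e]
  have hr : ∀ x, e (Sum.inr x) ∉ S := fun x => by simpa [e] using (e₂.symm x).2
  rintro (x | x) (y | y) <;> simp [h, hl, hr]

theorem card_le_two_of_not_hasChordedCycle (hG : ¬ HasChordedCycle G) {S R : Finset V}
    (h : ∀ v ∈ S, ∀ w ∈ R, G.Adj v w) : S.card ≤ 2 ∨ R.card ≤ 2 := by
  by_contra! hcon
  have emb : ∀ S : Finset V, 2 < S.card → ∃ f : Fin 3 → V, f.Injective ∧ ∀ i, f i ∈ S := by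
    intro S hS
    obtain ⟨a, b, c, ha, hb, hc, hab, hac, hbc⟩ := Finset.two_lt_card_iff.1 hS
    refine ⟨![a, b, c], ?_, ?_⟩
    · intro i j
      fin_cases i <;> fin_cases j <;> simp [hab, hac, hbc, hab.symm, hac.symm, hbc.symm]
    · intro i
      fin_cases i <;> simp [ha, hb, hc]
  obtain ⟨f, hf, hfS⟩ := emb S hcon.1
  obtain ⟨g, hg, hgR⟩ := emb R hcon.2
  exact hG (hasChordedCycle_of_three_three hf hg fun i j => h _ (hfS i) _ (hgR j))

end Bipartite

/-! ### Recognising triangle stars -/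

section TriangleStar

variable {V : Type*} [Fintype V] {G : SimpleGraph V} [DecidableRel G.Adj]

theorem exists_pairing_triangleNeighbors (hG : ¬ HasChordedCycle G) (u : V) :
    ∃ (n : ℕ) (φ : Fin n × Fin 2 → V), φ.Injective ∧
      (∀ a, a ∈ triangleNeighbors G u ↔ ∃ p, φ p = a) ∧
      ∀ p q, G.Adj (φ p) (φ q) ↔ p.1 = q.1 ∧ p.2 ≠ q.2 := by
  classical
  set T := triangleNeighbors G u with hT
  have hf : ∀ a, ∃ b, a ∈ T → b ∈ T ∧ G.Adj a b ∧ ∀ c ∈ T, G.Adj a c ↔ c = b := by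
    intro a
    by_cases ha : a ∈ T
    · obtain ⟨hua, b, hub, hab⟩ := mem_triangleNeighbors.1 ha
      refine ⟨b, fun _ => ⟨mem_triangleNeighbors.2 ⟨hub, a, hua, hab.symm⟩, hab, fun c hc =>
        ⟨fun hac => ?_, fun h => h ▸ hab⟩⟩⟩
      exact eq_of_adj_of_adj_neighborSet hG hua (mem_triangleNeighbors.1 hc).1 hub hac hab
    · exact ⟨a, fun h => absurd h ha⟩
  choose f hf using hf
  have hfT : ∀ a ∈ T, f a ∈ T := fun a ha => (hf a ha).1
  have hff : ∀ a ∈ T, f (f a) = a := fun a ha =>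
    (((hf (f a) (hfT a ha)).2.2 a ha).1 (hf a ha).2.1.symm).symm
  have hfne : ∀ a ∈ T, f a ≠ a := fun a ha => (hf a ha).2.1.ne'
  have hadj : ∀ a ∈ T, ∀ b ∈ T, G.Adj a b ↔ b = f a := fun a ha b hb => (hf a ha).2.2 b hb
  -- An arbitrary ordering of the vertices selects one end of each matching edge `{a, f a}`.
  let o := Fintype.equivFin V
  let T₀ := {a ∈ T | o a < o (f a)}
  let e := T₀.equivFin.symm
  have he : ∀ i, (e i : V) ∈ T ∧ o (e i) < o (f (e i)) := fun i => Finset.mem_filter.1 (e i).2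
  have hne : ∀ i j, (e i : V) ≠ f (e j) := by
    intro i j hij
    have h1 := (he i).2
    have h2 := (he j).2
    rw [hij, hff _ (he j).1] at h1
    exact lt_asymm h1 h2
  have hinj : ∀ i j, (e i : V) = e j ↔ i = j := fun i j => by
    rw [← Subtype.ext_iff, e.injective.eq_iff]
  have hfinj : ∀ i j, f (e i : V) = f (e j) ↔ i = j := fun i j => by
    refine ⟨fun h => ?_, fun h => h ▸ rfl⟩
    rw [← hinj, ← hff _ (he i).1, h, hff _ (he j).1]
  let φ : Fin T₀.card × Fin 2 → V := fun p => if p.2 = 0 then e p.1 else f (e p.1)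
  have hφT : ∀ p, φ p ∈ T := by
    rintro ⟨i, j⟩
    simp only [φ]
    split_ifs
    · exact (he i).1
    · exact hfT _ (he i).1
  refine ⟨T₀.card, φ, ?_, fun a => ⟨fun ha => ?_, ?_⟩, ?_⟩
  · rintro ⟨i, j⟩ ⟨i', j'⟩ h
    fin_cases j <;> fin_cases j' <;> simp [φ, hinj, hfinj, hne, (hne _ _).symm] at h ⊢ <;> exact h
  · rcases lt_or_ge (o a) (o (f a)) with h | h
    · refine ⟨(e.symm ⟨a, Finset.mem_filter.2 ⟨ha, h⟩⟩, 0), by simp [φ]⟩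
    · have h' : o (f a) < o a := lt_of_le_of_ne h (o.injective.ne (hfne a ha))
      refine ⟨(e.symm ⟨f a, Finset.mem_filter.2 ⟨hfT a ha, by rwa [hff a ha]⟩⟩, 1), ?_⟩
      simp [φ, hff a ha]
  · rintro ⟨p, rfl⟩
    exact hφT p
  · rintro ⟨i, j⟩ ⟨i', j'⟩
    rw [hadj _ (hφT _) _ (hφT _)]
    fin_cases j <;> fin_cases j' <;>
      simp [φ, hff _ (he _).1, hinj, hfinj, hne, (hne _ _).symm, eq_comm]

theorem card_triangleNeighbors_of_pairing {u : V} {n : ℕ} {φ : Fin n × Fin 2 → V}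
    (hφ : φ.Injective) (h : ∀ a, a ∈ triangleNeighbors G u ↔ ∃ p, φ p = a) :
    (triangleNeighbors G u).card = 2 * n := by
  classical
  have : triangleNeighbors G u = Finset.univ.image φ := by ext a; simp [h]
  rw [this, Finset.card_image_of_injective _ hφ]
  simp [mul_comm]

theorem nonempty_iso_triangleStar (hG : ¬ HasChordedCycle G) {u : V}
    (hu : ∀ w, w ≠ u → G.Adj u w) :
    ∃ n s, (triangleNeighbors G u).card = 2 * n ∧ (G.neighborFinset u).card = 2 * n + s ∧
      Nonempty (G ≃g triangleStar n s) := by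
  classical
  obtain ⟨n, φ, hφ, hφT, hφa⟩ := exists_pairing_triangleNeighbors hG u
  have hn := card_triangleNeighbors_of_pairing hφ hφT
  set T := triangleNeighbors G u with hT
  have hTN : T ⊆ G.neighborFinset u := Finset.filter_subset _ _
  set S := G.neighborFinset u \ T with hS
  have hTu : ∀ a ∈ T, G.Adj u a := fun a ha => (mem_triangleNeighbors.1 ha).1
  have hSu : ∀ a ∈ S, G.Adj u a := fun a ha =>
    (G.mem_neighborFinset u a).1 (Finset.mem_sdiff.1 ha).1
  have hSn : ∀ a ∈ S, ∀ b, G.Adj u b → ¬ G.Adj a b := fun a ha b hb hab =>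
    (Finset.mem_sdiff.1 ha).2 (mem_triangleNeighbors.2 ⟨hSu a ha, b, hb, hab⟩)
  let e := S.equivFin.symm
  let ψ : Fin S.card × Fin 1 → V := fun p => e p.1
  have hψS : ∀ p, ψ p ∈ S := fun p => (e p.1).2
  have hφT' : ∀ p, φ p ∈ T := fun p => (hφT _).2 ⟨p, rfl⟩
  have hψ : ψ.Injective := by
    rintro ⟨i, j⟩ ⟨i', j'⟩ h
    have : i = i' := e.injective (Subtype.ext h)
    rw [this, Subsingleton.elim j j']
  have hne : ∀ p q, φ p ≠ ψ q := fun p q h =>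
    (Finset.mem_sdiff.1 (hψS q)).2 (h ▸ hφT' p)
  have uφ : ∀ p, G.Adj u (φ p) := fun p => hTu _ (hφT' p)
  have uψ : ∀ p, G.Adj u (ψ p) := fun p => hSu _ (hψS p)
  refine ⟨n, S.card, hn, ?_, ?_⟩
  · rw [hS, Finset.card_sdiff_of_subset hTN, hn]
    have := Finset.card_le_card hTN
    omega
  let g : Fin 1 ⊕ ((Fin n × Fin 2) ⊕ (Fin S.card × Fin 1)) → V :=
    Sum.elim (fun _ => u) (Sum.elim φ ψ)
  have hg : g.Bijective := by
    constructor
    · rintro (x | x | x) (y | y | y) h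
      · rw [Subsingleton.elim x y]
      · exact absurd h (uφ y).ne
      · exact absurd h (uψ y).ne
      · exact absurd h.symm (uφ x).ne
      · rw [hφ h]
      · exact absurd h (hne x y)
      · exact absurd h.symm (uψ x).ne
      · exact absurd h.symm (hne y x)
      · rw [hψ h]
    · intro v
      by_cases hv : v = u
      · exact ⟨Sum.inl 0, hv.symm⟩
      by_cases hvT : v ∈ T
      · obtain ⟨p, hp⟩ := (hφT v).1 hvT
        exact ⟨Sum.inr (Sum.inl p), hp⟩
      · have hvS : v ∈ S := Finset.mem_sdiff.2 ⟨(G.mem_neighborFinset u v).2 (hu v hv), hvT⟩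
        exact ⟨Sum.inr (Sum.inr (e.symm ⟨v, hvS⟩, 0)), by simp [g, ψ]⟩
  refine ⟨RelIso.symm ⟨Equiv.ofBijective g hg, ?_⟩⟩
  rintro (x | x | x) (y | y | y) <;> simp only [Equiv.ofBijective_apply]
  · rw [Subsingleton.elim x y]
    simp
  · exact iff_of_true (uφ y) (triangleStar_adj_inl_inr _ _)
  · exact iff_of_true (uψ y) (triangleStar_adj_inl_inr _ _)
  · exact iff_of_true (uφ x).symm (triangleStar_adj_inl_inr _ _).symm
  · rw [triangleStar_adj_inr]
    refine (hφa x y).trans ?_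
    rcases x with ⟨i, j⟩
    rcases y with ⟨i', j'⟩
    simp
    grind
  · refine iff_of_false (fun h => hSn _ (hψS y) _ (uφ x) h.symm) ?_
    simp [triangleStar_adj_inr]
  · exact iff_of_true (uψ x).symm (triangleStar_adj_inl_inr _ _).symm
  · refine iff_of_false (fun h => hSn _ (hψS x) _ (uφ y) h) ?_
    simp [triangleStar_adj_inr]
  · refine iff_of_false (fun h => hSn _ (hψS x) _ (uψ y) h) ?_
    simp [triangleStar_adj_inr]

end TriangleStar

/-! ### Locating the largest root of the cubic -/

section Theta

/-- The cubic is nonnegative at `x + m + 1`, so it has a root beyond `x`. -/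
theorem lt_theta_of_neg {m : ℕ} {x : ℝ} (hx : 0 ≤ x)
    (h : x ^ 3 - x ^ 2 + (((m / 3 : ℕ) : ℝ) - m) * x + m - 3 * ((m / 3 : ℕ) : ℝ) < 0) :
    x < theta m := by
  have hub := (isGreatest_theta m).2
  have ht : (3 : ℝ) * ((m / 3 : ℕ) : ℝ) ≤ m := by exact_mod_cast Nat.mul_div_le m 3
  have ht0 : (0 : ℝ) ≤ ((m / 3 : ℕ) : ℝ) := Nat.cast_nonneg _
  generalize ((m / 3 : ℕ) : ℝ) = t at *
  have hcont : Continuous fun x : ℝ => x ^ 3 - x ^ 2 + (t - m) * x + m - 3 * t := by fun_prop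
  have h2 : 0 ≤ (fun x : ℝ => x ^ 3 - x ^ 2 + (t - m) * x + m - 3 * t) (x + m + 1) := by
    have hm : (0 : ℝ) ≤ m := Nat.cast_nonneg m
    simp only
    have hy : 0 ≤ x + m := by linarith
    generalize hz : x + (m : ℝ) = y at *
    have hmy : (m : ℝ) ≤ y := by linarith
    nlinarith [mul_nonneg hy hm, mul_nonneg hy hy, mul_nonneg hy ht0, mul_nonneg (mul_nonneg hy hy) hy,
      mul_nonneg (sub_nonneg.2 hmy) hy]
  obtain ⟨y, hy, hy0⟩ := intermediate_value_Icc
    (show x ≤ x + m + 1 by linarith [Nat.cast_nonneg (α := ℝ) m]) hcont.continuousOn ⟨h.le, h2⟩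
  have hyx : x ≠ y := by
    rintro rfl
    exact h.ne hy0
  exact (lt_of_le_of_ne hy.1 hyx).trans_le (hub hy0)

/-- At `√m` the cubic equals `-(3 - √m) ⌊m / 3⌋`, which is negative for `3 ≤ m < 9`. -/
theorem sqrt_lt_theta {m : ℕ} (hm : 3 ≤ m) (hm' : m < 9) : √(m : ℝ) < theta m := by
  refine lt_theta_of_neg (Real.sqrt_nonneg _) ?_
  have h1 : √(m : ℝ) ^ 2 = m := Real.sq_sqrt (Nat.cast_nonneg m)
  have h2 : √(m : ℝ) < 3 := by
    rw [Real.sqrt_lt' (by norm_num)]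
    have : (m : ℝ) < 9 := by exact_mod_cast hm'
    linarith
  have h3 : (0 : ℝ) < ((m / 3 : ℕ) : ℝ) := by
    have : 0 < m / 3 := by omega
    exact_mod_cast this
  generalize ((m / 3 : ℕ) : ℝ) = t at *
  nlinarith [mul_pos h3 (sub_pos.2 h2)]

end Theta

/-! ### The dichotomy and the extremal graphs -/

section Dichotomy

theorem exists_iso_completeBipartiteGraph_of_card_le_two {V : Type*}
    [Fintype V] [DecidableEq V] {G : SimpleGraph V} (hG : ¬ HasChordedCycle G)
    {S : Finset V}
    (h : ∀ v w, G.Adj v w ↔ (v ∈ S ↔ w ∉ S)) :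
    ∃ a b, a ≤ 2 ∧ Nonempty (G ≃g completeBipartiteGraph (Fin a) (Fin b)) := by
  rcases card_le_two_of_not_hasChordedCycle hG (S := S) (R := Sᶜ) (fun v hv w hw =>
    (h v w).2 (iff_of_true hv (Finset.mem_compl.1 hw))) with hS | hS
  · exact ⟨_, _, hS, nonempty_iso_completeBipartiteGraph h⟩
  · refine ⟨_, _, hS, nonempty_iso_completeBipartiteGraph fun v w => ?_⟩
    rw [h, Finset.mem_compl, Finset.mem_compl]
    tauto

theorem not_hasChordedCycle_of_extremal_large {V : Type*} {G : SimpleGraph V} {m : ℕ}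
    (h : IsExtremalLarge m G) : ¬ HasChordedCycle G := by
  rcases h with ⟨rfl, ⟨⟨e⟩⟩ | ⟨⟨e⟩⟩ | ⟨⟨e⟩⟩ | ⟨⟨e⟩⟩⟩ | ⟨hm, ⟨⟨e⟩⟩ | ⟨hev, ⟨e⟩⟩⟩
  · exact not_hasChordedCycle_of_iso_triangleStar e
  · exact not_hasChordedCycle_of_iso_triangleStar e
  · exact not_hasChordedCycle_of_iso_triangleStar e
  · exact not_hasChordedCycle_of_iso_completeBipartiteGraph one_le_two e
  · exact not_hasChordedCycle_of_iso_completeBipartiteGraph one_le_two e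
  · exact not_hasChordedCycle_of_iso_completeBipartiteGraph le_rfl e

variable {V : Type*} [Fintype V] [DecidableEq V] {G : SimpleGraph V} [DecidableRel G.Adj]

theorem sum_sum_neighborFinset_adjMatrix (hG : ¬ HasChordedCycle G) (u : V) :
    ∑ a ∈ G.neighborFinset u, ∑ b ∈ G.neighborFinset u, G.adjMatrix ℝ a b
      = (triangleNeighbors G u).card := by
  have hTN : triangleNeighbors G u ⊆ G.neighborFinset u := Finset.filter_subset _ _
  rw [Finset.sum_congr rfl fun a ha =>
    sum_neighborFinset_adjMatrix hG ((G.mem_neighborFinset u a).1 ha)]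
  simp [Finset.inter_eq_right.2 hTN]

theorem three_mul_le_card_edgeFinset {u : V} {t : ℕ} (hG : ¬ HasChordedCycle G)
    (ht : (triangleNeighbors G u).card = 2 * t) : 3 * t ≤ G.edgeFinset.card := by
  have hcount := two_mul_card_edgeFinset_eq (G := G) u
  have hTN : triangleNeighbors G u ⊆ G.neighborFinset u := Finset.filter_subset _ _
  have h1 : ∑ a ∈ G.neighborFinset u, ∑ b ∈ G.neighborFinset u, G.adjMatrix ℝ a b = (2 * t : ℕ) := by
    rw [sum_sum_neighborFinset_adjMatrix hG, ht]
  have h2 : ∀ S R : Finset V, 0 ≤ ∑ a ∈ S, ∑ b ∈ R, G.adjMatrix ℝ a b := fun S R =>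
    Finset.sum_nonneg fun a _ => Finset.sum_nonneg fun b _ => adjMatrix_nonneg a b
  have h3 : ((2 * t : ℕ) : ℝ) ≤ (G.neighborFinset u).card := by
    exact_mod_cast ht ▸ Finset.card_le_card hTN
  rw [h1] at hcount
  have h4 := h2 (insert u (G.neighborFinset u))ᶜ (G.neighborFinset u)
  have h5 := h2 (insert u (G.neighborFinset u))ᶜ (insert u (G.neighborFinset u))ᶜ
  push_cast at *
  have : (3 * t : ℝ) ≤ G.edgeFinset.card := by linarith
  exact_mod_cast this

theorem card_edgeFinset_of_forall_adj {u : V} {t s : ℕ} (hG : ¬ HasChordedCycle G)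
    (hu : ∀ w, w ≠ u → G.Adj u w) (ht : (triangleNeighbors G u).card = 2 * t)
    (hs : (G.neighborFinset u).card = 2 * t + s) : G.edgeFinset.card = 3 * t + s := by
  have hcount := two_mul_card_edgeFinset_eq (G := G) u
  have h1 : ∑ a ∈ G.neighborFinset u, ∑ b ∈ G.neighborFinset u, G.adjMatrix ℝ a b = (2 * t : ℕ) := by
    rw [sum_sum_neighborFinset_adjMatrix hG, ht]
  have hW : (insert u (G.neighborFinset u))ᶜ = ∅ := by
    ext w
    simpa using fun hw : w ≠ u => hu w hw
  rw [h1, hW, hs] at hcount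
  simp only [Finset.sum_empty] at hcount
  push_cast at hcount
  have : (G.edgeFinset.card : ℝ) = 3 * t + s := by linarith
  exact_mod_cast this

theorem spectral_dichotomy (hG : ¬ HasChordedCycle G) (hiso : ∀ v, ¬ G.IsIsolated v)
    {r : ℝ} (hr : 2 < r) (heig : Module.End.HasEigenvalue (Matrix.toLin' (G.adjMatrix ℝ)) r)
    (hm : (G.edgeFinset.card : ℝ) ≤ r ^ 2) :
    ∃ t : ℕ, 3 * t ≤ G.edgeFinset.card ∧
      (r - 1) * (r ^ 2 - G.edgeFinset.card) ≤ (3 - r) * t ∧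
      ((r - 1) * (r ^ 2 - G.edgeFinset.card) = (3 - r) * t →
        (0 < t ∧ ∃ s, G.edgeFinset.card = 3 * t + s ∧ Nonempty (G ≃g triangleStar t s)) ∨
        (t = 0 ∧ ∃ a b, a ≤ 2 ∧ Nonempty (G ≃g completeBipartiteGraph (Fin a) (Fin b)))) := by
  obtain ⟨x, u, hx0, hx1, hxu, hsub⟩ := exists_normalized_subeigenvector (by linarith) heig
  obtain ⟨hle, heq⟩ := spectral_bound hG hx0 hx1 hxu hsub hr hm
  obtain ⟨t, φ, hφ, hφT, -⟩ := exists_pairing_triangleNeighbors hG u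
  have ht := card_triangleNeighbors_of_pairing hφ hφT
  have hcast : ((triangleNeighbors G u).card / 2 : ℝ) = t := by rw [ht]; push_cast; ring
  rw [hcast] at hle heq
  refine ⟨t, three_mul_le_card_edgeFinset hG ht, hle, fun h => ?_⟩
  have hst := heq h
  -- As `w` is not isolated and `W` is independent, `w` has a neighbour in `N`, hence is joined to
  -- all of `N`.
  have hall : ∀ w, w ≠ u → ¬ G.Adj u w → ∀ a, G.Adj u a → G.Adj w a := by
    intro w hwu hw
    have hne := hiso w
    simp only [IsIsolated, not_forall, not_not] at hne
    obtain ⟨v, hv⟩ := hne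
    refine (hst w hwu hw).2.2 ⟨v, hv, ?_⟩
    by_contra huv
    refine (hst w hwu hw).2.1 v ?_ huv hv
    rintro rfl
    exact hw hv.symm
  rcases Nat.eq_zero_or_pos t with rfl | htpos
  · right
    refine ⟨rfl, exists_iso_completeBipartiteGraph_of_card_le_two hG (S := G.neighborFinset u) ?_⟩
    have hT : ∀ a b, G.Adj u a → G.Adj u b → ¬ G.Adj a b := by
      intro a b ha hb hab
      have : a ∈ triangleNeighbors G u := mem_triangleNeighbors.2 ⟨ha, b, hb, hab⟩
      rw [Finset.card_eq_zero.1 ht] at this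
      exact Finset.notMem_empty a this
    have hall' : ∀ w, ¬ G.Adj u w → ∀ a, G.Adj u a → G.Adj w a := by
      intro w hw a ha
      by_cases hwu : w = u
      · rwa [hwu]
      · exact hall w hwu hw a ha
    intro v w
    simp only [mem_neighborFinset]
    by_cases hv : G.Adj u v <;> by_cases hw : G.Adj u w
    · simp [hv, hw, hT v w hv hw]
    · simp [hv, hw, (hall' w hw v hv).symm]
    · simp [hv, hw, hall' v hv w hw]
    · simp only [hv, hw, not_false_eq_true, iff_true, iff_false]
      intro hvw
      have hvu : v ≠ u := by rintro rfl; exact hw hvw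
      have hwu : w ≠ u := by rintro rfl; exact hv hvw.symm
      exact (hst v hvu hv).2.1 w hwu hw hvw
  · left
    refine ⟨htpos, ?_⟩
    have hu : ∀ w, w ≠ u → G.Adj u w := by
      intro w hwu
      by_contra hw
      obtain ⟨a, ha⟩ := Finset.card_pos.1 (ht ▸ (by omega) : 0 < (triangleNeighbors G u).card)
      -- A vertex outside `N ∪ {u}` would be joined to the triangle neighbour `a`, which equality
      -- forbids.
      exact (hst w hwu hw).1 a ha (hall w hwu hw a (mem_triangleNeighbors.1 ha).1)
    obtain ⟨n, s, hn, hs, he⟩ := nonempty_iso_triangleStar hG hu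
    have : n = t := by omega
    subst this
    exact ⟨s, card_edgeFinset_of_forall_adj hG hu hn hs, he⟩

theorem hasEigenvalue_rho (hE : 0 < G.edgeFinset.card) :
    Module.End.HasEigenvalue (Matrix.toLin' (G.adjMatrix ℝ)) (rho G) := by
  obtain ⟨e, -⟩ := Finset.card_pos.1 hE
  have : Nonempty V := ⟨e.out.1⟩
  exact (isGreatest_rho G).1

theorem extremal_small_of_theta_le (hG : ¬ HasChordedCycle G) (hiso : ∀ v, ¬ G.IsIsolated v)
    {m : ℕ} (hsize : G.edgeFinset.card = m) (hm : 4 ≤ m) (hm8 : m ≤ 8)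
    (h : theta m ≤ rho G) : IsExtremalSmall m G ∧ rho G = theta m := by
  have hroot := (isGreatest_theta m).2
  have hθ := sqrt_lt_theta (show 3 ≤ m by omega) (by omega : m < 9)
  have hm4 : (4 : ℝ) ≤ m := by exact_mod_cast hm
  have hm8' : (m : ℝ) ≤ 8 := by exact_mod_cast hm8
  have h2 : 2 ≤ √(m : ℝ) := Real.le_sqrt_of_sq_le (by norm_num; linarith)
  have hsq : √(m : ℝ) ^ 2 = m := Real.sq_sqrt (Nat.cast_nonneg m)
  set r := rho G with hr
  have hr2 : 2 < r := by linarith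
  have hmr : (m : ℝ) < r ^ 2 := by nlinarith
  obtain ⟨t, h3t, hle, heq⟩ := spectral_dichotomy hG hiso hr2
    (hasEigenvalue_rho (by omega)) (by rw [hsize]; exact hmr.le)
  rw [hsize] at h3t hle heq
  have htm : t ≤ m / 3 := by omega
  have htm' : (t : ℝ) ≤ ((m / 3 : ℕ) : ℝ) := by exact_mod_cast htm
  have hpos : 0 ≤ r ^ 3 - r ^ 2 + (((m / 3 : ℕ) : ℝ) - m) * r + m - 3 * ((m / 3 : ℕ) : ℝ) := by
    by_contra! hneg
    exact absurd (lt_theta_of_neg (by linarith) hneg) (not_lt.2 h)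
  have hlt : 0 < (r - 1) * (r ^ 2 - m) := mul_pos (by linarith) (by linarith)
  have hr3 : r < 3 := by
    by_contra! hcon
    nlinarith [mul_nonneg (sub_nonneg.2 hcon) (Nat.cast_nonneg (α := ℝ) t)]
  have hmul : (3 - r) * t ≤ (3 - r) * ((m / 3 : ℕ) : ℝ) :=
    mul_le_mul_of_nonneg_left htm' (by linarith)
  -- Nonnegativity of the cubic at `r` is the reverse of `hle` with `⌊m / 3⌋` for `t`, and `3 - r >
  -- 0` can be cancelled.
  have hteq : t = m / 3 := by
    have : (3 - r) * (t : ℝ) = (3 - r) * ((m / 3 : ℕ) : ℝ) := le_antisymm hmul (by nlinarith)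
    exact_mod_cast mul_left_cancel₀ (by linarith : (3 - r) ≠ 0) this
  subst hteq
  have hzero : r ^ 3 - r ^ 2 + (((m / 3 : ℕ) : ℝ) - m) * r + m - 3 * ((m / 3 : ℕ) : ℝ) = 0 :=
    le_antisymm (by nlinarith) hpos
  refine ⟨?_, le_antisymm (hroot hzero) h⟩
  rcases heq (by nlinarith) with ⟨-, s, hs, he⟩ | ⟨h0, -⟩
  · have : s = m - 3 * (m / 3) := by omega
    rw [this] at he
    exact he
  · omega

theorem extremal_large_of_sqrt_le (hG : ¬ HasChordedCycle G) (hiso : ∀ v, ¬ G.IsIsolated v)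
    {m : ℕ} (hsize : G.edgeFinset.card = m) (hm : 9 ≤ m)
    (h : √(m : ℝ) ≤ rho G) : IsExtremalLarge m G ∧ rho G = √(m : ℝ) := by
  have hm9 : (9 : ℝ) ≤ m := by exact_mod_cast hm
  have h3 : 3 ≤ √(m : ℝ) := Real.le_sqrt_of_sq_le (by norm_num; linarith)
  have hsq : √(m : ℝ) ^ 2 = m := Real.sq_sqrt (Nat.cast_nonneg m)
  set r := rho G with hr
  have hmr : (m : ℝ) ≤ r ^ 2 := by nlinarith
  obtain ⟨t, h3t, hle, heq⟩ := spectral_dichotomy hG hiso (by linarith)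
    (hasEigenvalue_rho (by omega)) (by rw [hsize]; exact hmr)
  rw [hsize] at h3t hle heq
  have ht0 : (0 : ℝ) ≤ t := Nat.cast_nonneg t
  have hnn : 0 ≤ (r - 1) * (r ^ 2 - m) := mul_nonneg (by linarith) (by linarith)
  have hnp : (3 - r) * (t : ℝ) ≤ 0 := mul_nonpos_of_nonpos_of_nonneg (by linarith) ht0
  -- As `r ≥ 3`, the estimate places a nonnegative quantity below a nonpositive one.
  have hz1 : (r - 1) * (r ^ 2 - m) = 0 := le_antisymm (by linarith) hnn
  have hz2 : (3 - r) * (t : ℝ) = 0 := le_antisymm hnp (by linarith)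
  have hrm : r ^ 2 = m := by
    rcases mul_eq_zero.1 hz1 with h | h <;> linarith
  refine ⟨?_, by rw [← hrm, Real.sqrt_sq (by linarith)]⟩
  rcases heq (hz1.trans hz2.symm) with ⟨htpos, s, hs, he⟩ | ⟨-, a, b, ha, ⟨e⟩⟩
  · left
    have hr3 : r = 3 := by
      rcases mul_eq_zero.1 hz2 with h | h
      · linarith
      · exact absurd (by exact_mod_cast h) htpos.ne'
    have hm' : m = 9 := by
      rw [hr3] at hrm
      exact_mod_cast (by linarith : (m : ℝ) = 9)
    subst hm'
    refine ⟨rfl, ?_⟩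
    have : t ≤ 3 := by omega
    interval_cases t
    · obtain rfl : s = 6 := by omega
      exact Or.inr (Or.inr (Or.inl he))
    · obtain rfl : s = 3 := by omega
      exact Or.inr (Or.inl he)
    · obtain rfl : s = 0 := by omega
      exact Or.inl he
  · have hab : m = a * b := by rw [← hsize, card_edgeFinset_of_iso_completeBipartiteGraph e]
    interval_cases a
    · omega
    · obtain rfl : b = m := by omega
      rcases Nat.eq_or_lt_of_le hm with rfl | hm10
      · exact Or.inl ⟨rfl, Or.inr (Or.inr (Or.inr ⟨e⟩))⟩
      · exact Or.inr ⟨hm10, Or.inl ⟨e⟩⟩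
    · obtain rfl : b = m / 2 := by omega
      exact Or.inr ⟨by omega, Or.inr ⟨by rw [hab]; exact even_two_mul _, ⟨e⟩⟩⟩

theorem theta_le_of_extremal_small {m : ℕ} (hm : 4 ≤ m) (hm8 : m ≤ 8)
    (h : IsExtremalSmall m G) : theta m ≤ rho G := by
  obtain ⟨e⟩ := h
  have hθ := sqrt_lt_theta (show 3 ≤ m by omega) (by omega : m < 9)
  have h1 : 1 ≤ √(m : ℝ) := Real.one_le_sqrt.2 (by exact_mod_cast (by omega : 1 ≤ m))
  refine le_rho_of_iso_triangleStar e (by linarith) ?_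
  have hroot : theta m ^ 3 - theta m ^ 2 + (((m / 3 : ℕ) : ℝ) - m) * theta m + m
      - 3 * ((m / 3 : ℕ) : ℝ) = 0 := (isGreatest_theta m).1
  rw [Nat.cast_sub (Nat.mul_div_le m 3)]
  push_cast
  linear_combination hroot

theorem sqrt_le_of_extremal_large {m : ℕ} (h : IsExtremalLarge m G) : √(m : ℝ) ≤ rho G := by
  have h9 : √((9 : ℕ) : ℝ) = 3 := by
    rw [show ((9 : ℕ) : ℝ) = 3 ^ 2 by norm_num, Real.sqrt_sq (by norm_num)]
  rcases h with ⟨rfl, ⟨⟨e⟩⟩ | ⟨⟨e⟩⟩ | ⟨⟨e⟩⟩ | ⟨⟨e⟩⟩⟩ | ⟨hm, ⟨⟨e⟩⟩ | ⟨hev, ⟨e⟩⟩⟩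
  · rw [h9]; exact le_rho_of_iso_triangleStar e (by norm_num) (by norm_num)
  · rw [h9]; exact le_rho_of_iso_triangleStar e (by norm_num) (by norm_num)
  · rw [h9]; exact le_rho_of_iso_triangleStar e (by norm_num) (by norm_num)
  · exact sqrt_le_rho_of_iso_completeBipartiteGraph one_pos (by norm_num) e
  · simpa using sqrt_le_rho_of_iso_completeBipartiteGraph one_pos (by omega) e
  · have := sqrt_le_rho_of_iso_completeBipartiteGraph two_pos (by omega) e
    rwa [Nat.mul_div_cancel' hev.two_dvd] at this

end Dichotomy

end ChordedCycle

theorem mainTheorem1 {V : Type*} [Fintype V] [DecidableEq V] (G : SimpleGraph V)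
    [DecidableRel G.Adj] (m : ℕ) (hiso : ∀ v : V, ¬ G.IsIsolated v)
    (hsize : G.edgeFinset.card = m) (hm : 4 ≤ m) :
    (m ≤ 8 →
      (ChordedCycle.theta m ≤ ChordedCycle.rho G →
        ChordedCycle.HasChordedCycle G ∨ ChordedCycle.IsExtremalSmall m G) ∧
      (¬ ChordedCycle.HasChordedCycle G →
        ChordedCycle.rho G ≤ ChordedCycle.theta m ∧
        (ChordedCycle.rho G = ChordedCycle.theta m ↔ ChordedCycle.IsExtremalSmall m G)) ∧
      (ChordedCycle.IsExtremalSmall m G → ¬ ChordedCycle.HasChordedCycle G)) ∧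
    (9 ≤ m →
      (Real.sqrt m ≤ ChordedCycle.rho G →
        ChordedCycle.HasChordedCycle G ∨ ChordedCycle.IsExtremalLarge m G) ∧
      (¬ ChordedCycle.HasChordedCycle G →
        ChordedCycle.rho G ≤ Real.sqrt m ∧
        (ChordedCycle.rho G = Real.sqrt m ↔ ChordedCycle.IsExtremalLarge m G)) ∧
      (ChordedCycle.IsExtremalLarge m G → ¬ ChordedCycle.HasChordedCycle G)) := by
  refine ⟨fun hm8 => ?_, fun hm9 => ?_⟩
  · have hmain := fun hG => ChordedCycle.extremal_small_of_theta_le (G := G) hG hiso hsize hm hm8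
    have hconv := ChordedCycle.theta_le_of_extremal_small (G := G) hm hm8
    refine ⟨fun h => ?_, fun hG => ⟨?_, fun h => (hmain hG h.ge).1, fun h =>
      (hmain hG (hconv h)).2⟩, ?_⟩
    · by_cases hG : ChordedCycle.HasChordedCycle G
      · exact Or.inl hG
      · exact Or.inr (hmain hG h).1
    · by_contra! h
      exact h.ne' (hmain hG h.le).2
    · rintro ⟨e⟩
      exact ChordedCycle.not_hasChordedCycle_of_iso_triangleStar e
  · have hmain := fun hG => ChordedCycle.extremal_large_of_sqrt_le (G := G) hG hiso hsize hm9
    have hconv := ChordedCycle.sqrt_le_of_extremal_large (G := G) (m := m)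
    refine ⟨fun h => ?_, fun hG => ⟨?_, fun h => (hmain hG h.ge).1, fun h =>
      (hmain hG (hconv h)).2⟩, ChordedCycle.not_hasChordedCycle_of_extremal_large⟩
    · by_cases hG : ChordedCycle.HasChordedCycle G
      · exact Or.inl hG
      · exact Or.inr (hmain hG h).1
    · by_contra! h
      exact h.ne' (hmain hG h.le).2
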